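/- Let $1<p<3$ and $1<q<3$, put $p^*=\frac{3p}{3-p}$ and $q^*=\frac{3q}{3-q}$, and let $s$ be a real number with $$\frac{(q^*-1)p}{q^*}<s<\frac{(q^*-1)p^*}{q^*}.$$ Let $W^{1,p}(\mathbb{R}^3)$ be the usual Sobolev space of real-valued functions, and let $D^{1,q}(\mathbb{R}^3)$ be the completion of $C_0^\infty(\mathbb{R}^3)$ with respect to the norm $\|v\|_{D^{1,q}}=\left(\int_{\mathbb{R}^3}|\nabla v|^q\,dx\right)^{1/q}$, regarded as a space of functions in $L^{q^*}(\mathbb{R}^3)$ by means of the Sobolev inequality. Then for every $u\in W^{1,p}(\mathbb{R}^3)$ there exists a unique (up to equality almost everywhere) $\phi_u\in D^{1,q}(\mathbb{R}^3)$ that solves $$-\Delta_q\phi=|u|^s,\qquad \Delta_q\phi=\operatorname{div}\left(|\nabla\phi|^{q-2}\nabla\phi\right),$$ in the weak sense, that is, for all $v\in D^{1,q}(\mathbb{R}^3)$ both integrals below converge absolutely and $$\int_{\mathbb{R}^3}|\nabla\phi_u|^{q-2}\nabla\phi_u\cdot\nabla v\,dx=\int_{\mathbb{R}^3}|u|^s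 v\,dx .$$ -/

import Mathlib

open MeasureTheory Filter Topology
open scoped ENNReal ContDiff RealInnerProductSpace

noncomputable section

namespace QPoisson

/-- Three-dimensional Euclidean space. -/
abbrev E3 : Type := EuclideanSpace ℝ (Fin 3)

/-- The critical Sobolev exponent `p* = 3p / (3 - p)` in dimension three (used for `1 < p < 3`). -/
def sobolevExp (p : ℝ) : ℝ := 3 * p / (3 - p)

/-- `η` is a real-valued smooth compactly supported function on `ℝ³`. -/
def IsTest (η : E3 → ℝ) : Prop := ContDiff ℝ ∞ η ∧ HasCompactSupport η

/-- `g` is a weak gradient of `u`: both are locally integrable, and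
`∫ u ∇η = - ∫ η g` for every test function `η`. -/
def HasWeakGradient (u : E3 → ℝ) (g : E3 → E3) : Prop :=
  LocallyIntegrable u ∧ LocallyIntegrable g ∧
    ∀ η : E3 → ℝ, IsTest η → ∫ x, u x • gradient η x = - ∫ x, η x • g x

/-- `u` belongs to the Sobolev space `W^{1,p}(ℝ³)`. -/
def MemW (p : ℝ) (u : E3 → ℝ) : Prop :=
  MemLp u (ENNReal.ofReal p) ∧
    ∃ g : E3 → E3, HasWeakGradient u g ∧ MemLp g (ENNReal.ofReal p)

/-- The norm `(∫ |∇v|^q)^{1/q}` of a test function `v`. -/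
def gradNorm (q : ℝ) (v : E3 → ℝ) : ℝ≥0∞ :=
  eLpNorm (fun x => gradient v x) (ENNReal.ofReal q) volume

/-- `v` belongs to `D^{1,q}(ℝ³)`, for `1 < q < 3`. This is the completion of the test functions for
`gradNorm q`, realized as a space of functions in `L^{q*}` through the Sobolev inequality: a
`gradNorm q`-Cauchy sequence of test functions converges in `L^{q*}`, and the element of the
completion that it defines is identified with its limit there. -/
def MemD (q : ℝ) (v : E3 → ℝ) : Prop :=
  MemLp v (ENNReal.ofReal (sobolevExp q)) ∧
    ∃ φ : ℕ → E3 → ℝ,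
      (∀ n, IsTest (φ n)) ∧
      (∀ ε : ℝ≥0∞, 0 < ε → ∃ N, ∀ m ≥ N, ∀ n ≥ N, gradNorm q (fun x => φ m x - φ n x) < ε) ∧
      Tendsto (fun n => eLpNorm (fun x => φ n x - v x) (ENNReal.ofReal (sobolevExp q)) volume)
        atTop (𝓝 0)

/-- `φ ∈ D^{1,q}(ℝ³)` solves `-Δ_q φ = |u|^s` in the dual space of `D^{1,q}(ℝ³)`: for all
`v ∈ D^{1,q}(ℝ³)` one has `∫ |∇φ|^{q-2} ∇φ · ∇v = ∫ |u|^s v`, both integrals being absolutely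
convergent. The gradients are the weak gradients, which elements of `D^{1,q}(ℝ³)` possess and which
are unique up to null sets. -/
def IsWeakSolution (q s : ℝ) (u φ : E3 → ℝ) : Prop :=
  MemD q φ ∧ ∃ g : E3 → E3, HasWeakGradient φ g ∧
    ∀ (v : E3 → ℝ) (h : E3 → E3), MemD q v → HasWeakGradient v h →
      Integrable (fun x => ‖g x‖ ^ (q - 2) * ⟪g x, h x⟫) ∧
      Integrable (fun x => |u x| ^ s * v x) ∧
      ∫ x, ‖g x‖ ^ (q - 2) * ⟪g x, h x⟫ = ∫ x, |u x| ^ s * v x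

end QPoisson

end

/-! The equation is the Euler–Lagrange equation of the energy `‖∇v‖_q ^ q / q - ∫ |u|^s v` on
`D^{1,q}`, so existence comes from minimization and uniqueness from strict monotonicity of `a ↦
‖a‖^(q-2) a`.

The bounds on `s` say exactly that `s (q*)'` lies strictly between `p` and `p*`, where `(q*)'` is
the conjugate exponent of `q*`. The Sobolev embedding of `W^{1,p}` and interpolation then put
`|u|^s` in `L^{(q*)'}`, and by Hölder `v ↦ ∫ |u|^s v` is a bounded functional on `L^{q*}`
(`MemW.memLp_abs_rpow`).

`D^{1,q}` is handled as a closed subspace of `L^{q*} × L^q`, the closure of the pairs `(φ, ∇φ)`.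
There the Sobolev inequality makes the energy coercive. Weak compactness is not needed: uniform
convexity of `L^q` makes a minimizing sequence Cauchy (`exists_energy_minimizer`), and
differentiating the energy along lines at the minimizer gives the weak equation. -/

noncomputable section

namespace QPoisson

/-! ### Convexity and monotonicity inequalities for `‖·‖ ^ q` -/

section Pointwise

variable {E : Type*} [NormedAddCommGroup E] [InnerProductSpace ℝ E]

/-- For equal norms the gain comes from strict convexity of the ball; for different norms, from
strict convexity of `t ↦ t ^ q`. -/
theorem norm_midpoint_rpow_lt {q : ℝ} (hq : 1 < q) {a b : E} (hab : a ≠ b) :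
    ‖(2⁻¹ : ℝ) • (a + b)‖ ^ q < (‖a‖ ^ q + ‖b‖ ^ q) / 2 := by
  by_cases h : ‖a‖ = ‖b‖
  · have h1 : ‖(2⁻¹ : ℝ) • (a + b)‖ < ‖a‖ := by
      have := norm_combo_lt_of_ne (r := ‖a‖) le_rfl h.ge hab
        (by norm_num : (0 : ℝ) < 2⁻¹) (by norm_num : (0 : ℝ) < 2⁻¹) (by norm_num)
      rwa [← smul_add] at this
    calc _ < ‖a‖ ^ q := Real.rpow_lt_rpow (norm_nonneg _) h1 (by linarith)
      _ = _ := by rw [h]; ring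
  · have h1 : ‖(2⁻¹ : ℝ) • (a + b)‖ ≤ 2⁻¹ * ‖a‖ + 2⁻¹ * ‖b‖ := by
      rw [norm_smul, ← mul_add, Real.norm_of_nonneg (by norm_num)]
      gcongr
      exact norm_add_le _ _
    have h2 := (strictConvexOn_rpow hq).2 (norm_nonneg a) (norm_nonneg b) h
      (by norm_num : (0 : ℝ) < 2⁻¹) (by norm_num : (0 : ℝ) < 2⁻¹) (by norm_num)
    simp only [smul_eq_mul] at h2
    calc _ ≤ (2⁻¹ * ‖a‖ + 2⁻¹ * ‖b‖) ^ q := Real.rpow_le_rpow (norm_nonneg _) h1 (by linarith)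
      _ < _ := h2
      _ = _ := by ring

theorem norm_midpoint_rpow_le {q : ℝ} (hq : 1 < q) (a b : E) :
    ‖(2⁻¹ : ℝ) • (a + b)‖ ^ q ≤ (‖a‖ ^ q + ‖b‖ ^ q) / 2 := by
  rcases eq_or_ne a b with rfl | h
  · rw [← two_smul ℝ a, smul_smul]; simp
  · exact (norm_midpoint_rpow_lt hq h).le

/-- A quantitative form of the strict convexity of `‖·‖ ^ q`, which integrates to the uniform
convexity of `L^q`. -/
theorem exists_norm_sub_rpow_le [ProperSpace E] {q : ℝ} (hq : 1 < q) {ε : ℝ} (hε : 0 < ε) :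
    ∃ C : ℝ, 0 ≤ C ∧ ∀ a b : E, ‖a - b‖ ^ q ≤ ε * (‖a‖ ^ q + ‖b‖ ^ q) +
      C * ((‖a‖ ^ q + ‖b‖ ^ q) / 2 - ‖(2⁻¹ : ℝ) • (a + b)‖ ^ q) := by
  have hq0 : 0 < q := by linarith
  -- By homogeneity it is enough to treat `‖a‖ ^ q + ‖b‖ ^ q = 1`. The pairs there with `‖a - b‖ ^ q
  -- ≥ ε` form a compact set, on which the continuous, positive midpoint gap `G` has a positive
  -- lower bound `δ`.
  let K : Set (E × E) := {z | ‖z.1‖ ^ q + ‖z.2‖ ^ q = 1 ∧ ε ≤ ‖z.1 - z.2‖ ^ q}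
  let G : E × E → ℝ := fun z => (‖z.1‖ ^ q + ‖z.2‖ ^ q) / 2 - ‖(2⁻¹ : ℝ) • (z.1 + z.2)‖ ^ q
  have hGc : Continuous G := by
    dsimp only [G]
    fun_prop (disch := simp [hq0.le])
  have hle : ∀ a b : E, ‖a‖ ^ q + ‖b‖ ^ q = 1 → ‖a‖ ≤ 1 ∧ ‖b‖ ≤ 1 := by
    intro a b h
    have ha : 0 ≤ ‖a‖ ^ q := by positivity
    have hb : 0 ≤ ‖b‖ ^ q := by positivity
    constructor
    · refine (Real.rpow_le_rpow_iff (norm_nonneg _) zero_le_one hq0).1 ?_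
      rw [Real.one_rpow]; linarith
    · refine (Real.rpow_le_rpow_iff (norm_nonneg _) zero_le_one hq0).1 ?_
      rw [Real.one_rpow]; linarith
  have hK : IsCompact K := by
    refine (isCompact_closedBall (0 : E × E) 1).of_isClosed_subset ?_ ?_
    · have h1 : IsClosed {z : E × E | ‖z.1‖ ^ q + ‖z.2‖ ^ q = 1} :=
        isClosed_eq (by fun_prop (disch := simp [hq0.le])) continuous_const
      have h2 : IsClosed {z : E × E | ε ≤ ‖z.1 - z.2‖ ^ q} :=
        isClosed_le continuous_const (by fun_prop (disch := simp [hq0.le]))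
      exact h1.inter h2
    · rintro ⟨a, b⟩ ⟨h, -⟩
      simpa [Prod.norm_def] using hle a b h
  obtain ⟨δ, hδ, hδK⟩ : ∃ δ : ℝ, 0 < δ ∧ ∀ z ∈ K, δ ≤ G z := by
    rcases K.eq_empty_or_nonempty with h | h
    · exact ⟨1, one_pos, by simp [h]⟩
    · obtain ⟨z, hz, hmin⟩ := hK.exists_isMinOn h hGc.continuousOn
      refine ⟨G z, ?_, fun w hw => hmin hw⟩
      have hne : z.1 ≠ z.2 := by
        intro h
        have := hz.2
        rw [h, sub_self, norm_zero, Real.zero_rpow hq0.ne'] at this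
        linarith
      have := norm_midpoint_rpow_lt hq hne
      simp only [G]; linarith
  -- On `K` one has `‖a - b‖ ^ q ≤ 2 ^ q` and `δ ≤ G`, so this multiple of `G` dominates; off `K`
  -- the term `ε` suffices.
  refine ⟨2 ^ q / δ, by positivity, fun a b => ?_⟩
  have hG0 : ∀ a b : E, 0 ≤ G (a, b) := fun a b => by
    have := norm_midpoint_rpow_le hq a b
    simp only [G]; linarith
  have key : ∀ a b : E, ‖a‖ ^ q + ‖b‖ ^ q = 1 → ‖a - b‖ ^ q ≤ ε + 2 ^ q / δ * G (a, b) := by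
    intro a b h
    by_cases hab : ε ≤ ‖a - b‖ ^ q
    · have h1 : ‖a - b‖ ^ q ≤ 2 ^ q := by
        refine Real.rpow_le_rpow (norm_nonneg _) ?_ hq0.le
        linarith [norm_sub_le a b, hle a b h]
      have h2 : 2 ^ q / δ * δ ≤ 2 ^ q / δ * G (a, b) := by
        gcongr
        exact hδK (a, b) ⟨h, hab⟩
      rw [div_mul_cancel₀ _ hδ.ne'] at h2
      linarith
    · have : 0 ≤ 2 ^ q / δ * G (a, b) := mul_nonneg (by positivity) (hG0 a b)
      linarith
  by_cases h0 : ‖a‖ ^ q + ‖b‖ ^ q = 0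
  · have ha : 0 ≤ ‖a‖ ^ q := by positivity
    have hb : 0 ≤ ‖b‖ ^ q := by positivity
    have ha0 : a = 0 := by
      have : ‖a‖ ^ q = 0 := by linarith
      simpa [Real.rpow_eq_zero_iff_of_nonneg, hq0.ne'] using this
    have hb0 : b = 0 := by
      have : ‖b‖ ^ q = 0 := by linarith
      simpa [Real.rpow_eq_zero_iff_of_nonneg, hq0.ne'] using this
    subst ha0 hb0
    simp [hq0.ne']
  · have hpos : 0 < ‖a‖ ^ q + ‖b‖ ^ q := lt_of_le_of_ne (by positivity) (Ne.symm h0)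
    set N := ‖a‖ ^ q + ‖b‖ ^ q with hN
    let t : ℝ := (N ^ (q⁻¹))⁻¹
    have ht : 0 < t := by positivity
    have htq : t ^ q = N⁻¹ := by
      rw [Real.inv_rpow (by positivity), ← Real.rpow_mul hpos.le, inv_mul_cancel₀ hq0.ne',
        Real.rpow_one]
    have hsc : ∀ x : E, ‖t • x‖ ^ q = N⁻¹ * ‖x‖ ^ q := fun x => by
      rw [norm_smul, Real.norm_of_nonneg ht.le, Real.mul_rpow ht.le (norm_nonneg _), htq]
    have h := key (t • a) (t • b) (by rw [hsc, hsc, ← mul_add, ← hN, inv_mul_cancel₀ h0])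
    simp only [G] at h
    rw [← smul_sub, ← smul_add, smul_comm, hsc, hsc, hsc, hsc] at h
    have h3 := mul_le_mul_of_nonneg_left h hpos.le
    have e1 : ∀ y, N * (N⁻¹ * y) = y := fun y => by field_simp
    rw [e1] at h3
    refine h3.trans_eq ?_
    rw [← mul_add, ← hN]
    field_simp

/-- For `q ≤ 2` the value of `x ^ (q - 2)` at `0` is a convention; it is harmless because of the
factor `x`. -/
theorem rpow_sub_two_mul_self {q : ℝ} (hq : 1 < q) {x : ℝ} (hx : 0 ≤ x) :
    x ^ (q - 2) * x = x ^ (q - 1) := by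
  rcases hx.eq_or_lt with rfl | hx
  · rw [mul_zero, Real.zero_rpow (by linarith)]
  · rw [← Real.rpow_add_one hx.ne']; ring_nf

/-- Bounds the `t`-derivative of `‖a + t • b‖ ^ q` uniformly for `|t| ≤ 1`; this is the dominating
function when differentiating under the integral. -/
theorem norm_rpow_sub_two_mul_inner_le {q : ℝ} (hq : 1 < q) (a b : E) {t : ℝ} (ht : |t| ≤ 1) :
    ‖q * (‖a + t • b‖ ^ (q - 2) * ⟪a + t • b, b⟫)‖ ≤ q * (‖a‖ + ‖b‖) ^ q := by
  have hq0 : 0 < q := by linarith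
  have h1 : ‖a + t • b‖ ≤ ‖a‖ + ‖b‖ := by
    refine (norm_add_le _ _).trans ?_
    rw [norm_smul, Real.norm_eq_abs]
    gcongr
    exact mul_le_of_le_one_left (norm_nonneg _) ht
  generalize a + t • b = c at h1
  have h2 : ‖c‖ ^ (q - 1) ≤ (‖a‖ + ‖b‖) ^ (q - 1) :=
    Real.rpow_le_rpow (norm_nonneg _) h1 (by linarith)
  have h3 : (‖a‖ + ‖b‖) ^ q = (‖a‖ + ‖b‖) ^ (q - 1) * (‖a‖ + ‖b‖) := by
    rw [← Real.rpow_add_one' (by positivity) (by linarith)]; ring_nf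
  rw [norm_mul, norm_mul, Real.norm_of_nonneg hq0.le,
    Real.norm_of_nonneg (show 0 ≤ ‖c‖ ^ (q - 2) by positivity), h3]
  refine mul_le_mul_of_nonneg_left ?_ hq0.le
  calc ‖c‖ ^ (q - 2) * ‖⟪c, b⟫‖ ≤ ‖c‖ ^ (q - 2) * (‖c‖ * ‖b‖) :=
        mul_le_mul_of_nonneg_left (norm_inner_le_norm _ _) (by positivity)
    _ = ‖c‖ ^ (q - 1) * ‖b‖ := by
        rw [← mul_assoc, rpow_sub_two_mul_self hq (norm_nonneg _)]
    _ ≤ (‖a‖ + ‖b‖) ^ (q - 1) * (‖a‖ + ‖b‖) :=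
        mul_le_mul h2 (by linarith [norm_nonneg a]) (norm_nonneg _) (by positivity)

theorem hasDerivAt_norm_add_smul_rpow {q : ℝ} (hq : 1 < q) (a b : E) (t : ℝ) :
    HasDerivAt (fun t : ℝ => ‖a + t • b‖ ^ q)
      (q * (‖a + t • b‖ ^ (q - 2) * ⟪a + t • b, b⟫)) t := by
  have h1 : HasDerivAt (fun t : ℝ => a + t • b) b t := by
    simpa using ((hasDerivAt_id t).smul_const b).const_add a
  refine ((hasFDerivAt_norm_rpow (a + t • b) hq).comp_hasDerivAt t h1).congr_deriv ?_
  simp [inner_add_left, inner_smul_left]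
  ring

/-- The expression splits into a term measuring the difference of the norms and a Cauchy–Schwarz
defect, both nonnegative. If both vanish, the norms agree and the vectors are aligned. -/
theorem rpow_sub_two_mul_inner_sub_nonneg {q : ℝ} (hq : 1 < q) (a b : E) :
    0 ≤ ‖a‖ ^ (q - 2) * ⟪a, a - b⟫ - ‖b‖ ^ (q - 2) * ⟪b, a - b⟫ ∧
    (‖a‖ ^ (q - 2) * ⟪a, a - b⟫ - ‖b‖ ^ (q - 2) * ⟪b, a - b⟫ = 0 → a = b) := by
  have ha := rpow_sub_two_mul_self hq (norm_nonneg a)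
  have hb := rpow_sub_two_mul_self hq (norm_nonneg b)
  have hca := real_inner_le_norm a b
  have pa : 0 ≤ ‖a‖ ^ (q - 2) := by positivity
  have pb : 0 ≤ ‖b‖ ^ (q - 2) := by positivity
  have e : ‖a‖ ^ (q - 2) * ⟪a, a - b⟫ - ‖b‖ ^ (q - 2) * ⟪b, a - b⟫ =
      (‖a‖ ^ (q - 1) - ‖b‖ ^ (q - 1)) * (‖a‖ - ‖b‖) +
        (‖a‖ ^ (q - 2) + ‖b‖ ^ (q - 2)) * (‖a‖ * ‖b‖ - ⟪a, b⟫) := by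
    rw [inner_sub_right, inner_sub_right, real_inner_self_eq_norm_sq, real_inner_self_eq_norm_sq,
      real_inner_comm a b, ← ha, ← hb]
    ring
  have hq1 : 0 < q - 1 := by linarith
  have hmono : 0 ≤ (‖a‖ ^ (q - 1) - ‖b‖ ^ (q - 1)) * (‖a‖ - ‖b‖) := by
    rcases le_total ‖a‖ ‖b‖ with h | h
    · have := Real.rpow_le_rpow (norm_nonneg _) h hq1.le
      nlinarith
    · have := Real.rpow_le_rpow (norm_nonneg _) h hq1.le
      nlinarith
  have hcs : 0 ≤ (‖a‖ ^ (q - 2) + ‖b‖ ^ (q - 2)) * (‖a‖ * ‖b‖ - ⟪a, b⟫) :=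
    mul_nonneg (by positivity) (by linarith)
  rw [e]
  refine ⟨by positivity, fun h => ?_⟩
  have h1 : (‖a‖ ^ (q - 1) - ‖b‖ ^ (q - 1)) * (‖a‖ - ‖b‖) = 0 := by linarith
  have h2 : (‖a‖ ^ (q - 2) + ‖b‖ ^ (q - 2)) * (‖a‖ * ‖b‖ - ⟪a, b⟫) = 0 := by linarith
  have hn : ‖a‖ = ‖b‖ := by
    rcases mul_eq_zero.1 h1 with h | h
    · exact (Real.rpow_left_inj (norm_nonneg _) (norm_nonneg _) hq1.ne').1 (by linarith)
    · linarith
  by_cases h0 : ‖a‖ = 0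
  · have hb0 : ‖b‖ = 0 := by rw [← hn, h0]
    rw [norm_eq_zero.1 h0, norm_eq_zero.1 hb0]
  · have hap : 0 < ‖a‖ := lt_of_le_of_ne (norm_nonneg _) (Ne.symm h0)
    have : 0 < ‖a‖ ^ (q - 2) := by positivity
    have h3 : ‖a‖ * ‖b‖ - ⟪a, b⟫ = 0 := by
      rcases mul_eq_zero.1 h2 with h | h
      · linarith
      · exact h
    have h4 : ‖a - b‖ ^ 2 = 0 := by
      rw [norm_sub_sq_real, ← hn]; rw [← hn] at h3; nlinarith
    exact sub_eq_zero.1 (norm_eq_zero.1 (by simpa using h4))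

end Pointwise

/-! ### Gradients and test functions -/

theorem gradient_apply_eq (v : E3 → ℝ) (x : E3) :
    gradient v x = (InnerProductSpace.toDual ℝ E3).symm (fderiv ℝ v x) := rfl

theorem inner_gradient (v : E3 → ℝ) (x w : E3) : ⟪gradient v x, w⟫ = fderiv ℝ v x w := by
  rw [gradient_apply_eq, InnerProductSpace.toDual_symm_apply]

theorem norm_gradient (v : E3 → ℝ) (x : E3) : ‖gradient v x‖ = ‖fderiv ℝ v x‖ := by
  rw [gradient_apply_eq, LinearIsometryEquiv.norm_map]

namespace IsTest

variable {φ ψ : E3 → ℝ}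

theorem differentiable (hφ : IsTest φ) : Differentiable ℝ φ := hφ.1.differentiable (by simp)

theorem continuous (hφ : IsTest φ) : Continuous φ := hφ.1.continuous

theorem continuous_gradient (hφ : IsTest φ) : Continuous (fun x => gradient φ x) :=
  (InnerProductSpace.toDual ℝ E3).symm.continuous.comp (hφ.1.continuous_fderiv (by simp))

theorem hasCompactSupport_gradient (hφ : IsTest φ) : HasCompactSupport (fun x => gradient φ x) :=
  (hφ.2.fderiv ℝ).comp_left (g := (InnerProductSpace.toDual ℝ E3).symm) (map_zero _)

theorem add (hφ : IsTest φ) (hψ : IsTest ψ) : IsTest (fun x => φ x + ψ x) :=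
  ⟨hφ.1.add hψ.1, hφ.2.add hψ.2⟩

theorem const_mul (hφ : IsTest φ) (c : ℝ) : IsTest (fun x => c * φ x) :=
  ⟨contDiff_const.mul hφ.1, hφ.2.mul_left⟩

theorem gradient_add (hφ : IsTest φ) (hψ : IsTest ψ) (x : E3) :
    gradient (fun x => φ x + ψ x) x = gradient φ x + gradient ψ x := by
  simp only [gradient_apply_eq]
  rw [fderiv_fun_add (hφ.differentiable x) (hψ.differentiable x), map_add]

theorem gradient_sub (hφ : IsTest φ) (hψ : IsTest ψ) (x : E3) :
    gradient (fun x => φ x - ψ x) x = gradient φ x - gradient ψ x := by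
  simp only [gradient_apply_eq]
  rw [fderiv_fun_sub (hφ.differentiable x) (hψ.differentiable x), map_sub]

theorem gradient_const_mul (hφ : IsTest φ) (c : ℝ) (x : E3) :
    gradient (fun x => c * φ x) x = c • gradient φ x := by
  simp only [gradient_apply_eq]
  rw [fderiv_const_mul (hφ.differentiable x), map_smul]

theorem memLp (hφ : IsTest φ) (p : ℝ≥0∞) : MemLp φ p volume :=
  hφ.continuous.memLp_of_hasCompactSupport hφ.2

theorem memLp_gradient (hφ : IsTest φ) (p : ℝ≥0∞) : MemLp (fun x => gradient φ x) p volume :=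
  hφ.continuous_gradient.memLp_of_hasCompactSupport hφ.hasCompactSupport_gradient

theorem hasWeakGradient (hφ : IsTest φ) : HasWeakGradient φ (fun x => gradient φ x) := by
  refine ⟨hφ.continuous.locallyIntegrable, hφ.continuous_gradient.locallyIntegrable,
    fun η hη => ?_⟩
  have i1 : Integrable (fun x => φ x • gradient η x) :=
    (hφ.continuous.smul hη.continuous_gradient).integrable_of_hasCompactSupport hφ.2.smul_right
  have i2 : Integrable (fun x => η x • gradient φ x) :=
    (hη.continuous.smul hφ.continuous_gradient).integrable_of_hasCompactSupport hη.2.smul_right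
  refine ext_inner_left ℝ fun w => ?_
  rw [inner_neg_right, ← integral_inner i1 w,
    ← integral_inner i2 w]
  have h1 : ∀ x, ⟪w, φ x • gradient η x⟫ = φ x * fderiv ℝ η x w := fun x => by
    rw [inner_smul_right, real_inner_comm, inner_gradient]
  have h2 : ∀ x, ⟪w, η x • gradient φ x⟫ = fderiv ℝ φ x w * η x := fun x => by
    rw [inner_smul_right, real_inner_comm, inner_gradient, mul_comm]
  have j1 := i1.const_inner (𝕜 := ℝ) w
  have j2 := i2.const_inner (𝕜 := ℝ) w
  simp only [h1] at j1 ⊢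
  simp only [h2] at j2 ⊢
  refine integral_mul_fderiv_eq_neg_fderiv_mul_of_integrable j2 j1 ?_
    (fun x _ => hφ.differentiable x) (fun x _ => hη.differentiable x)
  exact (hφ.continuous.mul hη.continuous).integrable_of_hasCompactSupport hφ.2.mul_right

end IsTest

/-! ### Weak gradients up to null sets -/

theorem HasWeakGradient.ae_unique {v : E3 → ℝ} {g h : E3 → E3} (hg : HasWeakGradient v g)
    (hh : HasWeakGradient v h) : g =ᵐ[volume] h :=
  ae_eq_of_integral_contDiff_smul_eq hg.2.1 hh.2.1 fun η h1 h2 => by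
    rw [← neg_inj, ← hg.2.2 η ⟨h1, h2⟩, ← hh.2.2 η ⟨h1, h2⟩]

theorem LocallyIntegrable.congr_ae {F : Type*} [NormedAddCommGroup F] {f g : E3 → F}
    (hf : LocallyIntegrable f) (h : f =ᵐ[volume] g) : LocallyIntegrable g := fun x => by
  obtain ⟨s, hs, hi⟩ := hf x
  exact ⟨s, hs, hi.congr (ae_restrict_of_ae h)⟩

theorem HasWeakGradient.congr_ae {v w : E3 → ℝ} {g h : E3 → E3} (hg : HasWeakGradient v g)
    (hv : v =ᵐ[volume] w) (hh : g =ᵐ[volume] h) : HasWeakGradient w h := by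
  refine ⟨LocallyIntegrable.congr_ae hg.1 hv, LocallyIntegrable.congr_ae hg.2.1 hh,
    fun η hη => ?_⟩
  rw [← integral_congr_ae (f := fun x => v x • gradient η x) (by
      filter_upwards [hv] with x hx using by simp only [hx]), hg.2.2 η hη,
    integral_congr_ae (g := fun x => η x • h x) (by
      filter_upwards [hh] with x hx using by simp only [hx])]

/-! ### The critical exponent and the Sobolev inequality -/

section Exponents

variable {q : ℝ}

theorem sobolevExp_gt (hq1 : 1 < q) (hq3 : q < 3) : 3 / 2 < sobolevExp q := by
  unfold sobolevExp
  rw [div_lt_div_iff₀ (by norm_num) (by linarith)]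
  linarith

theorem one_lt_sobolevExp (hq1 : 1 < q) (hq3 : q < 3) : 1 < sobolevExp q := by
  linarith [sobolevExp_gt hq1 hq3]

theorem exists_sobolev_const (hq1 : 1 < q) (hq3 : q < 3) :
    ∃ C : NNReal, ∀ φ : E3 → ℝ, ContDiff ℝ 1 φ → HasCompactSupport φ →
      eLpNorm φ (ENNReal.ofReal (sobolevExp q)) volume ≤
        C * eLpNorm (fderiv ℝ φ) (ENNReal.ofReal q) volume := by
  refine ⟨_, fun φ h1 h2 => eLpNorm_le_eLpNorm_fderiv_of_eq_inner volume h1 h2 ?_ ?_ ?_⟩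
  · rw [← Real.toNNReal_one]; exact Real.toNNReal_le_toNNReal hq1.le
  · simp
  · have := one_lt_sobolevExp hq1 hq3
    rw [Real.coe_toNNReal _ (by linarith), NNReal.coe_inv,
      Real.coe_toNNReal _ (by linarith), sobolevExp]
    simp only [finrank_euclideanSpace, Fintype.card_fin]
    have : 3 - q ≠ 0 := by linarith
    field_simp
    ring

theorem exists_gradNorm_const (hq1 : 1 < q) (hq3 : q < 3) :
    ∃ C : NNReal, ∀ φ : E3 → ℝ, IsTest φ →
      eLpNorm φ (ENNReal.ofReal (sobolevExp q)) volume ≤ C * gradNorm q φ := by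
  obtain ⟨C, hC⟩ := exists_sobolev_const hq1 hq3
  refine ⟨C, fun φ hφ => (hC φ (hφ.1.of_le (by simp)) hφ.2).trans_eq ?_⟩
  rw [gradNorm, eLpNorm_congr_norm_ae (g := fun x => gradient φ x)]
  exact Eventually.of_forall fun x => (norm_gradient φ x).symm

end Exponents

/-- By Hölder. It carries the integration by parts identity, tested against a fixed function,
through `L^p` limits. -/
theorem continuous_integral_bilinear {E F G : Type*} [NormedAddCommGroup E] [NormedSpace ℝ E]
    [NormedAddCommGroup F] [NormedSpace ℝ F] [NormedAddCommGroup G] [NormedSpace ℝ G]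
    [CompleteSpace G] {p p' : ℝ≥0∞} [Fact (1 ≤ p)] [ENNReal.HolderConjugate p p']
    (B : E →L[ℝ] F →L[ℝ] G) {k : E3 → F} (hk : MemLp k p' volume) :
    Continuous (fun f : Lp E p (volume : Measure E3) => ∫ x, B (f x) (k x)) := by
  have : Fact (1 ≤ p') := ⟨ENNReal.HolderConjugate.one_le p' p⟩
  have : (fun f : Lp E p (volume : Measure E3) => ∫ x, B (f x) (k x)) =
      fun f => (B.lpPairing volume p p').flip (hk.toLp k) f := by
    ext f
    rw [ContinuousLinearMap.flip_apply, ContinuousLinearMap.lpPairing_eq_integral]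
    refine integral_congr_ae ?_
    filter_upwards [hk.coeFn_toLp] with x hx
    rw [hx]
  rw [this]
  exact ContinuousLinearMap.continuous _

/-! ### `D^{1,q}` as a closed subspace of `L^{q*} × L^q` -/

section EnergySpace

/-- The space `L^{q*} × L^q` containing the pairs `(v, ∇v)` for `v` in `D^{1,q}`. -/
abbrev PairSpace (q : ℝ) : Type :=
  Lp ℝ (ENNReal.ofReal (sobolevExp q)) (volume : Measure E3) ×
    Lp E3 (ENNReal.ofReal q) (volume : Measure E3)

variable (q : ℝ) [Fact (1 ≤ ENNReal.ofReal q)] [Fact (1 ≤ ENNReal.ofReal (sobolevExp q))]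

/-- The pairs `(φ, ∇φ)` for test functions `φ`. -/
def testGraph : Submodule ℝ (PairSpace q) where
  carrier := {z | ∃ φ : E3 → ℝ, IsTest φ ∧ z.1 =ᵐ[volume] φ ∧
    z.2 =ᵐ[volume] fun x => gradient φ x}
  zero_mem' := by
    refine ⟨fun _ => 0, ⟨contDiff_const, HasCompactSupport.zero⟩, Lp.coeFn_zero _ _ _, ?_⟩
    filter_upwards [Lp.coeFn_zero E3 (ENNReal.ofReal q) (volume : Measure E3)] with x hx
    simp only [Prod.snd_zero, hx, gradient_apply_eq]
    simp
  add_mem' := by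
    rintro a b ⟨φ, h1, h2, h3⟩ ⟨ψ, k1, k2, k3⟩
    refine ⟨_, h1.add k1, ?_, ?_⟩
    · filter_upwards [Lp.coeFn_add a.1 b.1, h2, k2] with x e1 e2 e3
      simp only [Prod.fst_add, e1, Pi.add_apply, e2, e3]
    · filter_upwards [Lp.coeFn_add a.2 b.2, h3, k3] with x e1 e2 e3
      simp only [Prod.snd_add, e1, Pi.add_apply, e2, e3, h1.gradient_add k1]
  smul_mem' := by
    rintro c a ⟨φ, h1, h2, h3⟩
    refine ⟨_, h1.const_mul c, ?_, ?_⟩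
    · filter_upwards [Lp.coeFn_smul c a.1, h2] with x e1 e2
      simp only [Prod.smul_fst, e1, Pi.smul_apply, e2, smul_eq_mul]
    · filter_upwards [Lp.coeFn_smul c a.2, h3] with x e1 e2
      simp only [Prod.smul_snd, e1, Pi.smul_apply, e2, h1.gradient_const_mul c]

/-- The pairs `(v, ∇v)` for `v` in `D^{1,q}`, as a closed subspace of `L^{q*} × L^q`. -/
def energySpace : Submodule ℝ (PairSpace q) :=
  (testGraph q).topologicalClosure

theorem isClosed_energySpace : IsClosed (energySpace q : Set (PairSpace q)) :=
  (testGraph q).isClosed_topologicalClosure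

variable {q}

theorem exists_seq_of_mem_energySpace
    {z : PairSpace q} (hz : z ∈ energySpace q) :
    ∃ φ : ℕ → E3 → ℝ, ∃ h : ∀ n, IsTest (φ n),
      Tendsto (fun n => ((h n).memLp (ENNReal.ofReal (sobolevExp q))).toLp) atTop (𝓝 z.1) ∧
      Tendsto (fun n => ((h n).memLp_gradient (ENNReal.ofReal q)).toLp) atTop (𝓝 z.2) := by
  obtain ⟨y, hy, hlim⟩ := mem_closure_iff_seq_limit.1 hz
  choose φ h1 h2 h3 using hy
  refine ⟨φ, h1, ?_, ?_⟩
  · refine ((continuous_fst.tendsto z).comp hlim).congr fun n => ?_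
    exact Lp.ext ((h2 n).trans (MemLp.coeFn_toLp _).symm)
  · refine ((continuous_snd.tendsto z).comp hlim).congr fun n => ?_
    exact Lp.ext ((h3 n).trans (MemLp.coeFn_toLp _).symm)

omit [Fact (1 ≤ ENNReal.ofReal q)] [Fact (1 ≤ ENNReal.ofReal (sobolevExp q))] in
theorem toLp_mem_testGraph {φ : E3 → ℝ} (h : IsTest φ) :
    ((h.memLp (ENNReal.ofReal (sobolevExp q))).toLp,
      (h.memLp_gradient (ENNReal.ofReal q)).toLp) ∈ testGraph q :=
  ⟨φ, h, (h.memLp _).coeFn_toLp, (h.memLp_gradient _).coeFn_toLp⟩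

/-- For a fixed test function the defining identity is a closed condition on the pair, and it holds
on the dense set of pairs `(φ, ∇φ)`. -/
theorem hasWeakGradient_of_mem_energySpace
    {z : PairSpace q} (hz : z ∈ energySpace q) :
    HasWeakGradient z.1 z.2 := by
  refine ⟨(Lp.memLp z.1).locallyIntegrable Fact.out, (Lp.memLp z.2).locallyIntegrable Fact.out,
    fun η hη => ?_⟩
  have i1 := ENNReal.HolderConjugate.conjExponent
    (Fact.out : 1 ≤ ENNReal.ofReal (sobolevExp q))
  have i2 := ENNReal.HolderConjugate.conjExponent (Fact.out : 1 ≤ ENNReal.ofReal q)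
  have c1 := continuous_integral_bilinear (p := ENNReal.ofReal (sobolevExp q))
    (p' := (ENNReal.ofReal (sobolevExp q)).conjExponent)
    (ContinuousLinearMap.lsmul ℝ ℝ) (hη.memLp_gradient _)
  have c2 := continuous_integral_bilinear (p := ENNReal.ofReal q)
    (p' := (ENNReal.ofReal q).conjExponent)
    (ContinuousLinearMap.lsmul (E := E3) ℝ ℝ).flip (hη.memLp _)
  simp only [ContinuousLinearMap.lsmul_apply, ContinuousLinearMap.flip_apply] at c1 c2
  have hcl := isClosed_eq (c1.comp continuous_fst) (c2.comp continuous_snd).neg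
  refine closure_minimal (s := (testGraph q : Set (PairSpace q))) ?_ hcl hz
  rintro y ⟨φ, h1, h2, h3⟩
  exact (h1.hasWeakGradient.congr_ae h2.symm h3.symm).2.2 η hη

/-- The Sobolev inequality survives passage to the closure, so the gradient component alone controls
the norm of the pair. -/
theorem norm_le_of_mem_energySpace (hq1 : 1 < q) (hq3 : q < 3) :
    ∃ C : ℝ, 0 ≤ C ∧ ∀ z ∈ energySpace q, ‖z.1‖ ≤ C * ‖z.2‖ := by
  obtain ⟨C, hC⟩ := exists_gradNorm_const hq1 hq3
  refine ⟨C, C.2, fun z hz => ?_⟩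
  have hcl : IsClosed {z : PairSpace q | ‖z.1‖ ≤ C * ‖z.2‖} :=
    isClosed_le (by fun_prop) (by fun_prop)
  refine closure_minimal (s := (testGraph q : Set (PairSpace q))) ?_ hcl hz
  rintro y ⟨φ, h1, h2, h3⟩
  have := hC φ h1
  rw [gradNorm, ← eLpNorm_congr_ae h2, ← eLpNorm_congr_ae h3] at this
  simp only [Set.mem_ofPred_eq, Lp.norm_def]
  have h := ENNReal.toReal_mono (ENNReal.mul_ne_top ENNReal.coe_ne_top (Lp.eLpNorm_ne_top _)) this
  rwa [ENNReal.toReal_mul] at h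

theorem memD_of_mem_energySpace
    {z : PairSpace q} (hz : z ∈ energySpace q) :
    MemD q z.1 := by
  refine ⟨Lp.memLp z.1, ?_⟩
  obtain ⟨φ, h, l1, l2⟩ := exists_seq_of_mem_energySpace hz
  refine ⟨φ, h, fun ε hε => ?_, ?_⟩
  · obtain ⟨N, hN⟩ := EMetric.cauchySeq_iff.1 l2.cauchySeq ε hε
    refine ⟨N, fun m hm n hn => ?_⟩
    have := hN m hm n hn
    rw [Lp.edist_toLp_toLp] at this
    refine lt_of_eq_of_lt (eLpNorm_congr_ae (Eventually.of_forall fun x => ?_)) this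
    exact (h m).gradient_sub (h n) x
  · have l1' := (Lp.tendsto_Lp_iff_tendsto_eLpNorm' _ _).1 l1
    refine l1'.congr fun n => eLpNorm_congr_ae ?_
    filter_upwards [((h n).memLp (ENNReal.ofReal (sobolevExp q))).coeFn_toLp] with x hx
    simp [hx]

/-- Completeness of `L^q` supplies the missing component, the limit of the gradients of the
approximating sequence. -/
theorem MemD.exists_mem_energySpace {v : E3 → ℝ} (hv : MemD q v) :
    ∃ z ∈ energySpace q, z.1 =ᵐ[volume] v := by
  obtain ⟨hv1, φ, h, hc, hl⟩ := hv
  have hcs : CauchySeq fun n => ((h n).memLp_gradient (ENNReal.ofReal q)).toLp := by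
    refine EMetric.cauchySeq_iff.2 fun ε hε => ?_
    obtain ⟨N, hN⟩ := hc ε hε
    refine ⟨N, fun m hm n hn => ?_⟩
    rw [Lp.edist_toLp_toLp]
    refine lt_of_eq_of_lt (eLpNorm_congr_ae (Eventually.of_forall fun x => ?_)) (hN m hm n hn)
    exact ((h m).gradient_sub (h n) x).symm
  obtain ⟨g, hg⟩ := cauchySeq_tendsto_of_complete hcs
  have hl' : Tendsto (fun n => ((h n).memLp (ENNReal.ofReal (sobolevExp q))).toLp) atTop
      (𝓝 (hv1.toLp v)) :=
    (Lp.tendsto_Lp_iff_tendsto_eLpNorm'' _ _ _ _).2 hl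
  exact ⟨(hv1.toLp v, g), mem_closure_of_tendsto (hl'.prodMk_nhds hg)
    (Eventually.of_forall fun n => toLp_mem_testGraph (h n)), hv1.coeFn_toLp⟩

theorem MemD.exists_mem_energySpace_of_hasWeakGradient {v : E3 → ℝ} (hv : MemD q v) {h : E3 → E3}
    (hh : HasWeakGradient v h) :
    ∃ z ∈ energySpace q, z.1 =ᵐ[volume] v ∧ z.2 =ᵐ[volume] h := by
  obtain ⟨z, hz, h1⟩ := hv.exists_mem_energySpace
  exact ⟨z, hz, h1, ((hasWeakGradient_of_mem_energySpace hz).congr_ae h1 .rfl).ae_unique hh⟩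

end EnergySpace

/-! ### Mollification and the Sobolev embedding of `W^{1,p}` -/

open scoped Convolution

/-- Young's inequality for the convolution with a probability density. -/
theorem eLpNorm_convolution_le {F : Type*} [NormedAddCommGroup F] [NormedSpace ℝ F]
    [MeasurableSpace F] [BorelSpace F] {ρ : E3 → ℝ} (hρ : Measurable ρ)
    (h1 : ∫⁻ x, ‖ρ x‖ₑ = 1) {f : E3 → F} (hf : AEStronglyMeasurable f volume) {p : ℝ}
    (hp : 1 ≤ p) :
    eLpNorm (ρ ⋆[ContinuousLinearMap.lsmul ℝ ℝ, volume] f) (ENNReal.ofReal p) volume ≤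
      eLpNorm f (ENNReal.ofReal p) volume := by
  have hp0 : 0 < p := by linarith
  -- A strongly measurable representative makes `(x, t) ↦ f (x - t)` jointly measurable, as Tonelli
  -- requires.
  wlog hfm : StronglyMeasurable f generalizing f
  · rw [convolution_congr (f' := ρ) (g' := hf.mk f) _ .rfl hf.ae_eq_mk,
      eLpNorm_congr_ae hf.ae_eq_mk]
    exact this hf.stronglyMeasurable_mk.aestronglyMeasurable hf.stronglyMeasurable_mk
  let ν : Measure E3 := volume.withDensity fun x => ‖ρ x‖ₑ
  have : IsProbabilityMeasure ν := ⟨by simp [ν, h1]⟩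
  have hpt : ∀ x, ‖(ρ ⋆[ContinuousLinearMap.lsmul ℝ ℝ, volume] f) x‖ₑ ^ p ≤
      ∫⁻ t, ‖f (x - t)‖ₑ ^ p ∂ν := by
    intro x
    have hm : StronglyMeasurable fun t => f (x - t) :=
      hfm.comp_measurable (measurable_const.sub measurable_id)
    have e1 : ‖(ρ ⋆[ContinuousLinearMap.lsmul ℝ ℝ, volume] f) x‖ₑ ≤ ∫⁻ t, ‖f (x - t)‖ₑ ∂ν := by
      rw [lintegral_withDensity_eq_lintegral_mul _ hρ.enorm hm.enorm]
      refine (enorm_integral_le_lintegral_enorm _).trans_eq (lintegral_congr fun t => ?_)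
      simp [enorm_smul]
    -- Jensen's inequality for the probability measure `ν`, in the form `L^1 ≤ L^p`.
    have e2 := eLpNorm'_le_eLpNorm'_of_exponent_le one_pos hp ν hm.aestronglyMeasurable
    rw [eLpNorm', eLpNorm'] at e2
    simp only [ENNReal.rpow_one, div_one] at e2
    calc _ ≤ ((∫⁻ t, ‖f (x - t)‖ₑ ^ p ∂ν) ^ (1 / p)) ^ p :=
          ENNReal.rpow_le_rpow (e1.trans e2) hp0.le
      _ = _ := by rw [← ENNReal.rpow_mul, one_div_mul_cancel hp0.ne', ENNReal.rpow_one]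
  have hp0' : ENNReal.ofReal p ≠ 0 := by simpa using hp0
  rw [eLpNorm_eq_lintegral_rpow_enorm_toReal hp0' ENNReal.ofReal_ne_top,
    eLpNorm_eq_lintegral_rpow_enorm_toReal hp0' ENNReal.ofReal_ne_top, ENNReal.toReal_ofReal hp0.le]
  refine ENNReal.rpow_le_rpow ?_ (by positivity)
  calc _ ≤ ∫⁻ x, ∫⁻ t, ‖f (x - t)‖ₑ ^ p ∂ν := lintegral_mono hpt
    _ = ∫⁻ t, (∫⁻ x, ‖f (x - t)‖ₑ ^ p) ∂ν := by
        refine lintegral_lintegral_swap (Measurable.aemeasurable ?_)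
        exact (hfm.comp_measurable (measurable_fst.sub measurable_snd)).enorm.pow_const p
    _ = _ := by
        simp only [lintegral_sub_right_eq_self fun x => ‖f x‖ₑ ^ p, lintegral_const, measure_univ,
          mul_one]

/-- The derivative first falls on `ρ`. Since `t ↦ ρ (x - t)` is a test function, the weak gradient
identity moves it onto `u`; the sign from reflecting `ρ` cancels the sign of that identity. -/
theorem HasWeakGradient.hasFDerivAt_convolution {u : E3 → ℝ} {g : E3 → E3}
    (h : HasWeakGradient u g) {ρ : E3 → ℝ} (hρ : IsTest ρ) (x : E3) :
    HasFDerivAt (ρ ⋆[ContinuousLinearMap.lsmul ℝ ℝ, volume] u)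
      (InnerProductSpace.toDual ℝ E3
        ((ρ ⋆[ContinuousLinearMap.lsmul ℝ ℝ, volume] g) x)) x := by
  have hd := hρ.2.hasFDerivAt_convolution_right (μ := volume)
    (ContinuousLinearMap.lsmul ℝ ℝ : ℝ →L[ℝ] ℝ →L[ℝ] ℝ).flip h.1 (hρ.1.of_le (by simp)) x
  rw [convolution_flip] at hd
  suffices e : InnerProductSpace.toDual ℝ E3
      ((ρ ⋆[ContinuousLinearMap.lsmul ℝ ℝ, volume] g) x) =
      (u ⋆[(ContinuousLinearMap.lsmul ℝ ℝ : ℝ →L[ℝ] ℝ →L[ℝ] ℝ).flip.precompR E3, volume]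
        fderiv ℝ ρ) x by
    rw [e]; exact hd
  refine ContinuousLinearMap.ext fun w => ?_
  rw [convolution_precompR_apply _ h.1 (hρ.2.fderiv ℝ) (hρ.1.continuous_fderiv (by simp))]
  let η : E3 → ℝ := fun t => ρ (x - t)
  have hη : IsTest η := by
    refine ⟨hρ.1.comp (contDiff_const.sub contDiff_id), ?_⟩
    exact hρ.2.comp_homeomorph (Homeomorph.subLeft x)
  have hηg : ∀ t, gradient η t = - gradient ρ (x - t) := fun t => by
    have : HasFDerivAt η (-(fderiv ℝ ρ (x - t))) t := by
      have := (hρ.differentiable (x - t)).hasFDerivAt.comp t ((hasFDerivAt_id t).const_sub x)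
      have e : -fderiv ℝ ρ (x - t) = fderiv ℝ ρ (x - t) ∘SL (-ContinuousLinearMap.id ℝ E3) :=
        ContinuousLinearMap.ext fun w => by simp
      rw [e]; exact this
    rw [gradient_apply_eq, this.fderiv, map_neg]
    rfl
  have key := h.2.2 η hη
  have e1 : (ρ ⋆[ContinuousLinearMap.lsmul ℝ ℝ, volume] g) x = ∫ t, η t • g t := by
    rw [convolution_eq_swap]; rfl
  have e2 : ∫ t, η t • g t = ∫ t, u t • gradient ρ (x - t) := by
    rw [← neg_inj, ← key, ← integral_neg]
    simp only [hηg, smul_neg]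
  have hi : Integrable fun t => u t • gradient ρ (x - t) := by
    have : Integrable fun t => u t • gradient η t := by
      have := h.1.integrable_smul_right_of_hasCompactSupport hη.continuous_gradient
        hη.hasCompactSupport_gradient
      exact this
    simpa [hηg] using this.neg
  rw [InnerProductSpace.toDual_apply_apply, e1, e2, real_inner_comm, ← integral_inner hi,
    convolution_def]
  refine integral_congr_ae (Eventually.of_forall fun t => ?_)
  simp only [inner_smul_right]
  rw [real_inner_comm, inner_gradient]
  simp [mul_comm]

/-- The Sobolev embedding of `W^{1,p}` into `L^{p*}`. -/
theorem MemW.memLp_sobolevExp {p : ℝ} (hp1 : 1 < p) (hp3 : p < 3) {u : E3 → ℝ} (hu : MemW p u) :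
    MemLp u (ENNReal.ofReal (sobolevExp p)) volume := by
  obtain ⟨hu, g, hg, hgp⟩ := hu
  obtain ⟨C, hC⟩ := exists_sobolev_const hp1 hp3
  let φ : ℕ → ContDiffBump (0 : E3) := fun n =>
    ⟨1 / ((n : ℝ) + 1), 2 * (1 / ((n : ℝ) + 1)), by positivity,
      by linarith [show 0 < 1 / ((n : ℝ) + 1) by positivity]⟩
  let ρ : ℕ → E3 → ℝ := fun n => (φ n).normed volume
  have hρ : ∀ n, IsTest (ρ n) := fun n => ⟨(φ n).contDiff_normed, (φ n).hasCompactSupport_normed⟩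
  have hρ1 : ∀ n, ∫⁻ x, ‖ρ n x‖ₑ = 1 := fun n => by
    have h0 : ∀ x, 0 ≤ ρ n x := fun x => (φ n).nonneg_normed x
    rw [lintegral_congr fun x => Real.enorm_of_nonneg (h0 x),
      ← ofReal_integral_eq_lintegral_ofReal (φ n).integrable_normed (Eventually.of_forall h0),
      (φ n).integral_normed, ENNReal.ofReal_one]
  let U : ℕ → E3 → ℝ := fun n => ρ n ⋆[ContinuousLinearMap.lsmul ℝ ℝ, volume] u
  let G : ℕ → E3 → E3 := fun n => ρ n ⋆[ContinuousLinearMap.lsmul ℝ ℝ, volume] g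
  have hU : ∀ n, ContDiff ℝ 1 (U n) := fun n =>
    (hρ n).2.contDiff_convolution_left (n := 1) _ ((hρ n).1.of_le (by simp)) hg.1
  have hUd : ∀ n x, fderiv ℝ (U n) x = InnerProductSpace.toDual ℝ E3 (G n x) := fun n x =>
    (hg.hasFDerivAt_convolution (hρ n) x).fderiv
  have hUlim : ∀ᵐ x, Tendsto (fun n => U n x) atTop (𝓝 (u x)) := by
    refine ContDiffBump.ae_convolution_tendsto_right_of_locallyIntegrable (φ := φ) (K := 2) ?_ ?_
      hg.1
    · have := (tendsto_one_div_add_atTop_nhds_zero_nat (𝕜 := ℝ)).const_mul 2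
      rwa [mul_zero] at this
    · exact Eventually.of_forall fun n => le_rfl
  -- The cutoffs `χ (x / (n + 1))` give the mollified functions compact support. Only the uniform
  -- bound `M` on their gradients is needed, because `u` itself lies in `L^p`.
  let χ : ContDiffBump (0 : E3) := ⟨1, 2, one_pos, one_lt_two⟩
  have hχd : Continuous (fderiv ℝ χ) := (χ.contDiff (n := 1)).continuous_fderiv one_ne_zero
  obtain ⟨M, hM⟩ := hχd.bounded_above_of_compact_support (χ.hasCompactSupport.fderiv ℝ)
  have hM0 : 0 ≤ M := (norm_nonneg _).trans (hM 0)
  let r : ℕ → ℝ := fun n => 1 / ((n : ℝ) + 1)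
  have hr0 : ∀ n, 0 < r n := fun n => by positivity
  have hr1 : ∀ n, r n ≤ 1 := fun n => by
    simp only [r]
    rw [div_le_one (by positivity)]
    linarith [(n.cast_nonneg : (0 : ℝ) ≤ n)]
  let X : ℕ → E3 → ℝ := fun n x => χ (r n • x)
  have hX : ∀ n, ContDiff ℝ 1 (X n) := fun n => χ.contDiff.comp (contDiff_const_smul _)
  have hXs : ∀ n, HasCompactSupport (X n) := fun n =>
    χ.hasCompactSupport.comp_homeomorph (Homeomorph.smulOfNeZero (r n) (hr0 n).ne')
  have hX1 : ∀ n x, ‖X n x‖ ≤ 1 := fun n x => by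
    rw [Real.norm_of_nonneg χ.nonneg]; exact χ.le_one
  have hXd : ∀ n x, ‖fderiv ℝ (X n) x‖ ≤ M := fun n x => by
    have : fderiv ℝ (X n) x = r n • fderiv ℝ χ (r n • x) := fderiv_comp_smul (f := χ) (r n)
    rw [this, norm_smul, Real.norm_of_nonneg (hr0 n).le]
    calc _ ≤ 1 * M := mul_le_mul (hr1 n) (hM _) (norm_nonneg _) zero_le_one
      _ = M := one_mul M
  have hXlim : ∀ x, ∀ᶠ n in atTop, X n x = 1 := fun x => by
    have : Tendsto (fun n => ‖r n • x‖) atTop (𝓝 0) := by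
      have := ((tendsto_one_div_add_atTop_nhds_zero_nat (𝕜 := ℝ)).smul_const x).norm
      simpa [r] using this
    filter_upwards [this.eventually (gt_mem_nhds one_pos)] with n hn
    exact χ.one_of_mem_closedBall (by simpa using hn.le)
  have hV : ∀ n, eLpNorm (fun x => X n x * U n x) (ENNReal.ofReal (sobolevExp p)) volume ≤
      C * (eLpNorm g (ENNReal.ofReal p) volume +
        ENNReal.ofReal M * eLpNorm u (ENNReal.ofReal p) volume) := by
    intro n
    refine (hC _ ((hX n).mul (hU n)) (hXs n).mul_right).trans ?_
    gcongr
    have hGm : AEStronglyMeasurable (G n) volume :=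
      ((hρ n).2.continuous_convolution_left _ (hρ n).continuous hg.2.1).aestronglyMeasurable
    have hUm : AEStronglyMeasurable (U n) volume := (hU n).continuous.aestronglyMeasurable
    have hb : ∀ x, ‖fderiv ℝ (fun x => X n x * U n x) x‖ ≤ ‖G n x‖ + M * ‖U n x‖ := fun x => by
      rw [fderiv_fun_mul ((hX n).differentiable one_ne_zero x)
        ((hU n).differentiable one_ne_zero x), hUd]
      refine (norm_add_le _ _).trans ?_
      rw [norm_smul, norm_smul, LinearIsometryEquiv.norm_map, mul_comm M]
      gcongr
      · exact mul_le_of_le_one_left (norm_nonneg _) (hX1 n x)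
      · exact hXd n x
    calc _ ≤ eLpNorm (fun x => ‖G n x‖ + M * ‖U n x‖) (ENNReal.ofReal p) volume :=
          eLpNorm_mono_real hb
      _ ≤ eLpNorm (fun x => ‖G n x‖) (ENNReal.ofReal p) volume +
          eLpNorm (fun x => M * ‖U n x‖) (ENNReal.ofReal p) volume :=
          eLpNorm_add_le hGm.norm (hUm.norm.const_mul M) (by simpa using hp1.le)
      _ = eLpNorm (G n) (ENNReal.ofReal p) volume +
          ENNReal.ofReal M * eLpNorm (U n) (ENNReal.ofReal p) volume := by
          rw [eLpNorm_norm, ← eLpNorm_norm (U n), ← Real.enorm_of_nonneg hM0,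
            ← eLpNorm_const_smul]
          rfl
      _ ≤ _ := by
          gcongr
          · exact eLpNorm_convolution_le (hρ n).continuous.measurable (hρ1 n) hgp.1 hp1.le
          · exact eLpNorm_convolution_le (hρ n).continuous.measurable (hρ1 n) hu.1 hp1.le
  have hlim : ∀ᵐ x, Tendsto (fun n => X n x * U n x) atTop (𝓝 (u x)) := by
    filter_upwards [hUlim] with x hx
    refine hx.congr' ?_
    filter_upwards [hXlim x] with n hn
    rw [hn, one_mul]
  -- Fatou: the bound `hV` is uniform in `n`, and the approximants converge almost everywhere to
  -- `u`.
  refine ⟨hu.1, (Lp.eLpNorm_le_of_ae_tendsto (Eventually.of_forall hV)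
    (fun n => ((hX n).continuous.mul (hU n).continuous).aestronglyMeasurable) hlim).trans_lt ?_⟩
  exact ENNReal.mul_lt_top ENNReal.coe_lt_top (ENNReal.add_lt_top.2
      ⟨hgp.2, ENNReal.mul_lt_top ENNReal.ofReal_lt_top hu.2⟩)

/-! ### Minimizing the energy and the Euler–Lagrange equation -/

section Minimization

variable {q : ℝ}

theorem Lp_integrable_norm_rpow (hq : 1 < q)
    (g : Lp E3 (ENNReal.ofReal q) (volume : Measure E3)) : Integrable fun x => ‖g x‖ ^ q := by
  have := (Lp.memLp g).integrable_norm_rpow (by simpa using by linarith) ENNReal.ofReal_ne_top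
  rwa [ENNReal.toReal_ofReal (by linarith)] at this

theorem Lp_integral_norm_rpow (hq : 1 < q)
    (g : Lp E3 (ENNReal.ofReal q) (volume : Measure E3)) : ∫ x, ‖g x‖ ^ q = ‖g‖ ^ q := by
  have hq0 : 0 < q := by linarith
  have h0 : 0 ≤ ∫ x, ‖g x‖ ^ q := integral_nonneg fun x => by positivity
  rw [Lp.norm_def, (Lp.memLp g).eLpNorm_eq_integral_rpow_norm (by simpa using hq0)
    ENNReal.ofReal_ne_top, ENNReal.toReal_ofReal hq0.le, ENNReal.toReal_ofReal (by positivity),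
    ← Real.rpow_mul h0, inv_mul_cancel₀ hq0.ne', Real.rpow_one]

variable [Fact (1 ≤ ENNReal.ofReal q)]

omit [Fact (1 ≤ ENNReal.ofReal q)] in
/-- Uniform convexity of `L^q`. -/
theorem exists_Lp_norm_sub_rpow_le (hq : 1 < q) {ε : ℝ} (hε : 0 < ε) :
    ∃ C : ℝ, 0 ≤ C ∧ ∀ a b : Lp E3 (ENNReal.ofReal q) (volume : Measure E3),
      ‖a - b‖ ^ q ≤ ε * (‖a‖ ^ q + ‖b‖ ^ q) +
        C * ((‖a‖ ^ q + ‖b‖ ^ q) / 2 - ‖(2⁻¹ : ℝ) • (a + b)‖ ^ q) := by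
  obtain ⟨C, hC0, hC⟩ := exists_norm_sub_rpow_le (E := E3) hq hε
  refine ⟨C, hC0, fun a b => ?_⟩
  have ia := Lp_integrable_norm_rpow hq a
  have ib := Lp_integrable_norm_rpow hq b
  have im := Lp_integrable_norm_rpow hq ((2⁻¹ : ℝ) • (a + b))
  have iab : Integrable fun x => ‖a x‖ ^ q + ‖b x‖ ^ q := ia.add ib
  have igap : Integrable fun x => (‖a x‖ ^ q + ‖b x‖ ^ q) / 2 -
      ‖((2⁻¹ : ℝ) • (a + b) : Lp E3 (ENNReal.ofReal q) (volume : Measure E3)) x‖ ^ q :=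
    (iab.div_const 2).sub im
  simp only [← Lp_integral_norm_rpow hq]
  rw [← integral_add ia ib, ← integral_div, ← integral_sub (iab.div_const 2) im,
    ← integral_const_mul, ← integral_const_mul,
    ← integral_add (iab.const_mul ε) (igap.const_mul C)]
  refine integral_mono_ae (Lp_integrable_norm_rpow hq (a - b))
    ((iab.const_mul ε).add (igap.const_mul C)) ?_
  filter_upwards [Lp.coeFn_sub a b, Lp.coeFn_smul (2⁻¹ : ℝ) (a + b), Lp.coeFn_add a b]
    with x e1 e2 e3
  simp only [e1, e2, e3, Pi.sub_apply, Pi.smul_apply, Pi.add_apply]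
  exact hC (a x) (b x)

variable [Fact (1 ≤ ENNReal.ofReal (sobolevExp q))]

/-- The energy `‖∇v‖_q ^ q / q - F v`. -/
def energy (F : Lp ℝ (ENNReal.ofReal (sobolevExp q)) (volume : Measure E3) →L[ℝ] ℝ)
    (z : PairSpace q) : ℝ := ‖z.2‖ ^ q / q - F z.1

theorem continuous_energy (hq : 1 < q)
    (F : Lp ℝ (ENNReal.ofReal (sobolevExp q)) (volume : Measure E3) →L[ℝ] ℝ) :
    Continuous (energy F) := by
  have : 0 ≤ q := by linarith
  unfold energy
  fun_prop (disch := simp [this])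

omit [Fact (1 ≤ ENNReal.ofReal q)] in
-- The linear term cancels in the midpoint gap, so near-minimality of the energy controls the
-- convexity gap of `‖·‖ ^ q`.
theorem energy_midpoint
    (F : Lp ℝ (ENNReal.ofReal (sobolevExp q)) (volume : Measure E3) →L[ℝ] ℝ) (y z : PairSpace q) :
    (‖y.2‖ ^ q + ‖z.2‖ ^ q) / 2 / q - ‖(2⁻¹ : ℝ) • (y.2 + z.2)‖ ^ q / q =
      (energy F y + energy F z) / 2 - energy F ((2⁻¹ : ℝ) • (y + z)) := by
  simp only [energy, Prod.smul_snd, Prod.smul_fst, Prod.snd_add, Prod.fst_add, map_smul, map_add,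
    smul_eq_mul]
  ring

omit [Fact (1 ≤ ENNReal.ofReal q)] [Fact (1 ≤ ENNReal.ofReal (sobolevExp q))] in
-- Lets half of the `q`-th power term absorb the linear term, giving coercivity. The threshold `T`
-- is where `t ^ q / (2 * q)` overtakes `K * t`.
theorem exists_mul_le_rpow_add (hq : 1 < q) {K : ℝ} (hK : 0 ≤ K) :
    ∃ B : ℝ, ∀ t : ℝ, 0 ≤ t → K * t ≤ t ^ q / (2 * q) + B := by
  have hq1 : 0 < q - 1 := by linarith
  set T : ℝ := (2 * q * K) ^ ((q - 1)⁻¹) with hT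
  have hT0 : 0 ≤ T := by positivity
  refine ⟨K * T, fun t ht => ?_⟩
  rcases le_total t T with h | h
  · have : 0 ≤ t ^ q / (2 * q) := by positivity
    nlinarith [mul_le_mul_of_nonneg_left h hK]
  · have h1 : T ^ (q - 1) = 2 * q * K := by
      rw [hT, ← Real.rpow_mul (by positivity), inv_mul_cancel₀ hq1.ne', Real.rpow_one]
    have h2 : T ^ (q - 1) ≤ t ^ (q - 1) := Real.rpow_le_rpow hT0 h hq1.le
    have h3 : t ^ q = t ^ (q - 1) * t := by
      rw [← Real.rpow_add_one' ht (by linarith)]; ring_nf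
    have h4 : 2 * q * K * t ≤ t ^ q := by
      rw [h3, ← h1]; exact mul_le_mul_of_nonneg_right h2 ht
    have h5 : K * t ≤ t ^ q / (2 * q) := by
      rw [le_div_iff₀ (by positivity)]; linarith
    have : 0 ≤ K * T := by positivity
    linarith

theorem exists_energy_minimizer (hq1 : 1 < q) (hq3 : q < 3)
    (F : Lp ℝ (ENNReal.ofReal (sobolevExp q)) (volume : Measure E3) →L[ℝ] ℝ) :
    ∃ m ∈ energySpace q, ∀ z ∈ energySpace q, energy F m ≤ energy F z := by
  have hq0 : 0 < q := by linarith
  obtain ⟨C, hC0, hC⟩ := norm_le_of_mem_energySpace hq1 hq3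
  obtain ⟨B, hB⟩ := exists_mul_le_rpow_add hq1 (K := ‖F‖ * C) (by positivity)
  have hlow : ∀ z ∈ energySpace q, ‖z.2‖ ^ q / (2 * q) - B ≤ energy F z := fun z hz => by
    have h1 : F z.1 ≤ ‖F‖ * C * ‖z.2‖ := by
      refine (le_abs_self _).trans ((F.le_opNorm z.1).trans ?_)
      rw [mul_assoc]
      exact mul_le_mul_of_nonneg_left (hC z hz) (norm_nonneg _)
    have h2 := hB ‖z.2‖ (norm_nonneg _)
    have h3 : ‖z.2‖ ^ q / q = 2 * (‖z.2‖ ^ q / (2 * q)) := by field_simp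
    rw [energy]
    linarith
  let S : Set ℝ := energy F '' (energySpace q : Set (PairSpace q))
  have hSb : BddBelow S := by
    refine ⟨-B, ?_⟩
    rintro _ ⟨z, hz, rfl⟩
    have : 0 ≤ ‖z.2‖ ^ q / (2 * q) := by positivity
    linarith [hlow z hz]
  have hSn : S.Nonempty := ⟨_, 0, (energySpace q).zero_mem, rfl⟩
  set I := sInf S
  have hI : ∀ z ∈ energySpace q, I ≤ energy F z := fun z hz => csInf_le hSb ⟨z, hz, rfl⟩
  have hex : ∀ n : ℕ, ∃ z ∈ energySpace q, energy F z < I + 1 / ((n : ℝ) + 1) := fun n => by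
    obtain ⟨_, ⟨z, hz, rfl⟩, h⟩ := exists_lt_of_csInf_lt hSn
      (show sInf S < I + 1 / ((n : ℝ) + 1) from lt_add_of_pos_right _ (by positivity))
    exact ⟨z, hz, h⟩
  choose z hz hzI using hex
  have hlim := tendsto_one_div_add_atTop_nhds_zero_nat (𝕜 := ℝ)
  have hzI1 : ∀ n, energy F (z n) ≤ I + 1 := fun n => by
    have : 1 / ((n : ℝ) + 1) ≤ 1 := by
      rw [div_le_one (by positivity)]
      linarith [(n.cast_nonneg : (0 : ℝ) ≤ n)]
    linarith [hzI n]
  have hR : ∀ n, ‖(z n).2‖ ^ q ≤ 2 * q * (I + 1 + B) := fun n => by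
    have : ‖(z n).2‖ ^ q / (2 * q) ≤ I + 1 + B := by linarith [hlow _ (hz n), hzI1 n]
    rw [div_le_iff₀ (by positivity)] at this
    linarith
  set R := 2 * q * (I + 1 + B)
  have hR0 : 0 ≤ R := le_trans (by positivity) (hR 0)
  have hcs : CauchySeq z := by
    refine Metric.cauchySeq_iff.2 fun δ hδ => ?_
    -- With this `η`, a gradient difference whose `q`-th power is below `η` forces both components
    -- of the pair to differ by less than `δ`.
    let η : ℝ := (δ / (C + 1)) ^ q
    have hη : 0 < η := by positivity
    obtain ⟨A, hA0, hA⟩ := exists_Lp_norm_sub_rpow_le hq1 (ε := η / (4 * (R + 1))) (by positivity)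
    have hlim2 : Tendsto (fun n : ℕ => A * (q * (1 / ((n : ℝ) + 1)))) atTop (𝓝 0) := by
      simpa using (hlim.const_mul q).const_mul A
    obtain ⟨N, hN⟩ := eventually_atTop.1 (hlim2.eventually (gt_mem_nhds (half_pos hη)))
    refine ⟨N, fun m hm n hn => ?_⟩
    have hdec : ∀ k, N ≤ k → 1 / ((k : ℝ) + 1) ≤ 1 / ((N : ℝ) + 1) := fun k hk => by
      gcongr
    -- The midpoint stays in the subspace, so its energy is at least the infimum `I`, while both
    -- endpoints lie within `1 / (N + 1)` of `I`.
    have hgap : (‖(z m).2‖ ^ q + ‖(z n).2‖ ^ q) / 2 - ‖(2⁻¹ : ℝ) • ((z m).2 + (z n).2)‖ ^ q ≤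
        q * (1 / ((N : ℝ) + 1)) := by
      have h1 := energy_midpoint F (z m) (z n)
      have h2 := hI _ ((energySpace q).smul_mem (2⁻¹ : ℝ)
        ((energySpace q).add_mem (hz m) (hz n)))
      rw [← sub_div] at h1
      have h3 := (div_le_iff₀ hq0).1 (h1.le.trans (show _ ≤ 1 / ((N : ℝ) + 1) by
        linarith [hzI m, hzI n, hdec m hm, hdec n hn]))
      linarith
    have h1 := hA (z m).2 (z n).2
    have h2 : η / (4 * (R + 1)) * (‖(z m).2‖ ^ q + ‖(z n).2‖ ^ q) ≤ η / 2 := by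
      calc _ ≤ η / (4 * (R + 1)) * (2 * (R + 1)) := by
            gcongr; linarith [hR m, hR n]
        _ = η / 2 := by field_simp; norm_num
    have h3 := (mul_le_mul_of_nonneg_left hgap hA0).trans_lt (hN N le_rfl)
    have h4 : ‖(z m).2 - (z n).2‖ ^ q < (δ / (C + 1)) ^ q := by
      change _ < η
      linarith
    have h5 := (Real.rpow_lt_rpow_iff (norm_nonneg _) (by positivity) hq0).1 h4
    rw [lt_div_iff₀ (by positivity)] at h5
    have h6 := hC _ ((energySpace q).sub_mem (hz m) (hz n))
    rw [Prod.fst_sub, Prod.snd_sub] at h6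
    rw [dist_eq_norm, Prod.norm_def, Prod.fst_sub, Prod.snd_sub, max_lt_iff]
    have h7 := norm_nonneg ((z m).2 - (z n).2)
    have h8 : 0 ≤ C * ‖(z m).2 - (z n).2‖ := by positivity
    constructor <;> linarith
  obtain ⟨m, hm⟩ := cauchySeq_tendsto_of_complete hcs
  have hmY : m ∈ energySpace q :=
    (isClosed_energySpace q).mem_of_tendsto hm (Eventually.of_forall hz)
  refine ⟨m, hmY, fun y hy => le_trans ?_ (hI y hy)⟩
  refine le_of_tendsto_of_tendsto (((continuous_energy hq1 F).tendsto m).comp hm)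
    (g := fun n : ℕ => I + 1 / ((n : ℝ) + 1)) ?_ (Eventually.of_forall fun n => (hzI n).le)
  simpa using hlim.const_add I

omit [Fact (1 ≤ ENNReal.ofReal q)] [Fact (1 ≤ ENNReal.ofReal (sobolevExp q))] in
theorem hasDerivAt_integral_norm_rpow (hq : 1 < q) {a b : E3 → E3}
    (ha : MemLp a (ENNReal.ofReal q) volume) (hb : MemLp b (ENNReal.ofReal q) volume) :
    Integrable (fun x => ‖a x‖ ^ (q - 2) * ⟪a x, b x⟫) ∧
    HasDerivAt (fun t : ℝ => ∫ x, ‖a x + t • b x‖ ^ q)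
      (q * ∫ x, ‖a x‖ ^ (q - 2) * ⟪a x, b x⟫) 0 := by
  have hq0 : 0 < q := by linarith
  have hint : ∀ c : E3 → E3, MemLp c (ENNReal.ofReal q) volume →
      Integrable fun x => ‖c x‖ ^ q := fun c hc => by
    have := hc.integrable_norm_rpow (by simpa using hq0) ENNReal.ofReal_ne_top
    rwa [ENNReal.toReal_ofReal hq0.le] at this
  have hbound : Integrable fun x => q * (‖a x‖ + ‖b x‖) ^ q := by
    have := (ha.norm.add hb.norm).integrable_norm_rpow (by simpa using hq0) ENNReal.ofReal_ne_top
    rw [ENNReal.toReal_ofReal hq0.le] at this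
    refine (this.congr (Eventually.of_forall fun x => ?_)).const_mul q
    simp only [Pi.add_apply]
    rw [Real.norm_of_nonneg (by positivity)]
  have hm : ∀ t : ℝ, AEStronglyMeasurable (fun x => ‖a x + t • b x‖ ^ q) volume := fun t =>
    (hint _ (ha.add (hb.const_smul t))).aestronglyMeasurable
  have h0 : Integrable fun x => ‖a x + (0 : ℝ) • b x‖ ^ q := by
    simpa only [zero_smul, add_zero] using hint a ha
  have hm' : AEStronglyMeasurable
      (fun x => q * (‖a x + (0 : ℝ) • b x‖ ^ (q - 2) * ⟪a x + (0 : ℝ) • b x, b x⟫)) volume := by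
    simp only [zero_smul, add_zero]
    exact ((ha.1.norm.aemeasurable.pow_const (q - 2)).aestronglyMeasurable.mul
      (ha.1.inner hb.1)).const_mul q
  obtain ⟨h1, h2⟩ := hasDerivAt_integral_of_dominated_loc_of_deriv_le
    (F := fun t x => ‖a x + t • b x‖ ^ q)
    (F' := fun t x => q * (‖a x + t • b x‖ ^ (q - 2) * ⟪a x + t • b x, b x⟫))
    (bound := fun x => q * (‖a x‖ + ‖b x‖) ^ q)
    (Metric.ball_mem_nhds (0 : ℝ) one_pos) (Eventually.of_forall hm) h0 hm'
    (Eventually.of_forall fun x t ht =>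
      norm_rpow_sub_two_mul_inner_le hq (a x) (b x) (by simpa using (mem_ball_zero_iff.1 ht).le))
    hbound
    (Eventually.of_forall fun x t _ => hasDerivAt_norm_add_smul_rpow hq (a x) (b x) t)
  simp only [zero_smul, add_zero] at h1 h2
  rw [integral_const_mul] at h2
  refine ⟨(h1.const_mul q⁻¹).congr (Eventually.of_forall fun x => ?_), h2⟩
  exact inv_mul_cancel_left₀ hq0.ne' _

/-- The energy along the line `m + t • y` has a minimum at `t = 0`, so its derivative vanishes
there. -/
theorem integral_eq_of_energy_minimizer (hq : 1 < q)
    {F : Lp ℝ (ENNReal.ofReal (sobolevExp q)) (volume : Measure E3) →L[ℝ] ℝ} {m : PairSpace q}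
    (hm : m ∈ energySpace q) (hmin : ∀ z ∈ energySpace q, energy F m ≤ energy F z)
    {y : PairSpace q} (hy : y ∈ energySpace q) :
    ∫ x, ‖m.2 x‖ ^ (q - 2) * ⟪m.2 x, y.2 x⟫ = F y.1 := by
  have hq0 : q ≠ 0 := by linarith
  have hd := (hasDerivAt_integral_norm_rpow hq (Lp.memLp m.2) (Lp.memLp y.2)).2
  have he : ∀ t : ℝ, energy F (m + t • y) =
      (∫ x, ‖m.2 x + t • y.2 x‖ ^ q) / q - (F m.1 + t * F y.1) := fun t => by
    simp only [energy, Prod.snd_add, Prod.fst_add, Prod.smul_snd, Prod.smul_fst, map_add, map_smul,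
      smul_eq_mul]
    rw [← Lp_integral_norm_rpow hq]
    congr 2
    refine integral_congr_ae ?_
    filter_upwards [Lp.coeFn_add m.2 (t • y.2), Lp.coeFn_smul t y.2] with x e1 e2
    rw [e1, Pi.add_apply, e2, Pi.smul_apply]
  have hd2 : HasDerivAt (fun t : ℝ => energy F (m + t • y))
      ((q * ∫ x, ‖m.2 x‖ ^ (q - 2) * ⟪m.2 x, y.2 x⟫) / q - F y.1) 0 := by
    simp only [he]
    have := ((hasDerivAt_id (0 : ℝ)).mul_const (F y.1)).const_add (F m.1)
    rw [one_mul] at this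
    exact (hd.div_const q).sub this
  have hloc : IsLocalMin (fun t : ℝ => energy F (m + t • y)) 0 := by
    refine Eventually.of_forall fun t => ?_
    simp only [zero_smul, add_zero]
    exact hmin _ ((energySpace q).add_mem hm ((energySpace q).smul_mem t hy))
  have := hloc.hasDerivAt_eq_zero hd2
  rw [mul_div_cancel_left₀ _ hq0] at this
  linarith

end Minimization

/-! ### Integrability of the right-hand side -/

/-- Pointwise `|u|^r ≤ |u|^p + |u|^t`, according to whether `|u|` is below or above `1`. -/
theorem memLp_of_memLp_of_lt {u : E3 → ℝ} {p r t : ℝ} (hp : 0 < p) (hpr : p < r) (hrt : r < t)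
    (h1 : MemLp u (ENNReal.ofReal p) volume) (h2 : MemLp u (ENNReal.ofReal t) volume) :
    MemLp u (ENNReal.ofReal r) volume := by
  have hr : 0 < r := by linarith
  have ht : 0 < t := by linarith
  have i1 := h1.integrable_norm_rpow (by simpa using hp) ENNReal.ofReal_ne_top
  have i2 := h2.integrable_norm_rpow (by simpa using ht) ENNReal.ofReal_ne_top
  rw [ENNReal.toReal_ofReal hp.le] at i1
  rw [ENNReal.toReal_ofReal ht.le] at i2
  rw [← integrable_norm_rpow_iff h1.1 (by simpa using hr) ENNReal.ofReal_ne_top,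
    ENNReal.toReal_ofReal hr.le]
  refine (i1.add i2).mono' (h1.1.norm.aemeasurable.pow_const r).aestronglyMeasurable
    (Eventually.of_forall fun x => ?_)
  rw [Real.norm_of_nonneg (by positivity), Pi.add_apply]
  have p1 : 0 ≤ ‖u x‖ ^ p := by positivity
  have p2 : 0 ≤ ‖u x‖ ^ t := by positivity
  rcases le_total 1 ‖u x‖ with h | h
  · linarith [Real.rpow_le_rpow_of_exponent_le h hrt.le]
  · rcases (norm_nonneg (u x)).eq_or_lt with h0 | h0
    · rw [← h0, Real.zero_rpow hr.ne', Real.zero_rpow hp.ne', Real.zero_rpow ht.ne', add_zero]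
    · linarith [Real.rpow_le_rpow_of_exponent_ge h0 h hpr.le]

/-- The right-hand side `|u|^s` lies in the dual Lebesgue space of `L^{q*}`. -/
theorem MemW.memLp_abs_rpow {p q s : ℝ} (hp1 : 1 < p) (hp3 : p < 3) (hq1 : 1 < q) (hq3 : q < 3)
    (hs1 : (sobolevExp q - 1) * p / sobolevExp q < s)
    (hs2 : s < (sobolevExp q - 1) * sobolevExp p / sobolevExp q)
    {u : E3 → ℝ} (hu : MemW p u) :
    MemLp (fun x => |u x| ^ s) (ENNReal.ofReal (sobolevExp q / (sobolevExp q - 1))) volume := by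
  have hQ := one_lt_sobolevExp hq1 hq3
  have hU := hu.memLp_sobolevExp hp1 hp3
  set Q := sobolevExp q
  have hQ1 : 0 < Q - 1 := by linarith
  have hs0 : 0 < s := lt_trans (by positivity) hs1
  -- The two remaining goals, `p < s * (Q / (Q - 1))` and `s * (Q / (Q - 1)) < p*`, are the two
  -- hypotheses on `s` rearranged.
  have h := memLp_of_memLp_of_lt (r := s * (Q / (Q - 1))) (by linarith) ?_ ?_ hu.1 hU
  · have := h.norm_rpow_div (ENNReal.ofReal s)
    rw [← ENNReal.ofReal_div_of_pos hs0, mul_div_cancel_left₀ _ hs0.ne',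
      ENNReal.toReal_ofReal hs0.le] at this
    exact this
  · rw [div_lt_iff₀ (by linarith)] at hs1
    rw [← mul_div_assoc, lt_div_iff₀ hQ1]
    linarith
  · rw [lt_div_iff₀ (by linarith)] at hs2
    rw [← mul_div_assoc, div_lt_iff₀ hQ1]
    linarith

/-! ### Existence and uniqueness -/

theorem fact_one_le_ofReal {r : ℝ} (hr : 1 < r) : Fact (1 ≤ ENNReal.ofReal r) :=
  ⟨by simpa using hr.le⟩

theorem exists_isWeakSolution {q s : ℝ} (hq1 : 1 < q) (hq3 : q < 3) {u : E3 → ℝ}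
    (hf : MemLp (fun x => |u x| ^ s) (ENNReal.ofReal (sobolevExp q / (sobolevExp q - 1))) volume) :
    ∃ φ, IsWeakSolution q s u φ := by
  have hQ := one_lt_sobolevExp hq1 hq3
  have := fact_one_le_ofReal hq1
  have := fact_one_le_ofReal hQ
  have hconj : ENNReal.HolderConjugate (ENNReal.ofReal (sobolevExp q / (sobolevExp q - 1)))
      (ENNReal.ofReal (sobolevExp q)) :=
    (Real.HolderConjugate.conjExponent hQ).symm.ennrealOfReal
  have : Fact (1 ≤ ENNReal.ofReal (sobolevExp q / (sobolevExp q - 1))) :=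
    ⟨ENNReal.HolderConjugate.one_le _ (ENNReal.ofReal (sobolevExp q))⟩
  let F : Lp ℝ (ENNReal.ofReal (sobolevExp q)) (volume : Measure E3) →L[ℝ] ℝ :=
    (ContinuousLinearMap.mul ℝ ℝ).lpPairing volume
      (ENNReal.ofReal (sobolevExp q / (sobolevExp q - 1))) _ hf.toLp
  have hF : ∀ v, F v = ∫ x, |u x| ^ s * v x := fun v => by
    refine (ContinuousLinearMap.lpPairing_eq_integral _ _ _).trans (integral_congr_ae ?_)
    filter_upwards [hf.coeFn_toLp] with x hx
    simp [hx]
  obtain ⟨m, hm, hmin⟩ := exists_energy_minimizer hq1 hq3 F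
  refine ⟨m.1, memD_of_mem_energySpace hm, m.2, hasWeakGradient_of_mem_energySpace hm,
    fun v h hv hh => ?_⟩
  obtain ⟨z, hz, hz1, hz2⟩ := hv.exists_mem_energySpace_of_hasWeakGradient hh
  have hc1 : (fun x => ‖m.2 x‖ ^ (q - 2) * ⟪m.2 x, z.2 x⟫) =ᵐ[volume]
      fun x => ‖m.2 x‖ ^ (q - 2) * ⟪m.2 x, h x⟫ := by
    filter_upwards [hz2] with x hx
    rw [hx]
  have hc2 : (fun x => |u x| ^ s * z.1 x) =ᵐ[volume] fun x => |u x| ^ s * v x := by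
    filter_upwards [hz1] with x hx
    rw [hx]
  refine ⟨(hasDerivAt_integral_norm_rpow hq1 (Lp.memLp m.2) (Lp.memLp z.2)).1.congr hc1,
    hf.integrable_mul hv.1, ?_⟩
  rw [← integral_congr_ae hc1, ← integral_congr_ae hc2,
    integral_eq_of_energy_minimizer hq1 hm hmin hz, hF]

/-- Testing both equations with `φ - ψ` and subtracting gives a nonnegative integrand with zero
integral. Strict monotonicity equates the gradients, and the Sobolev inequality then equates the
functions. -/
theorem IsWeakSolution.ae_unique {q s : ℝ} (hq1 : 1 < q) (hq3 : q < 3) {u φ ψ : E3 → ℝ}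
    (hφ : IsWeakSolution q s u φ) (hψ : IsWeakSolution q s u ψ) : φ =ᵐ[volume] ψ := by
  have := fact_one_le_ofReal hq1
  have := fact_one_le_ofReal (one_lt_sobolevExp hq1 hq3)
  obtain ⟨hφD, g, hg, hgs⟩ := hφ
  obtain ⟨hψD, k, hk, hks⟩ := hψ
  obtain ⟨y, hy, hy1, hy2⟩ := hφD.exists_mem_energySpace_of_hasWeakGradient hg
  obtain ⟨z, hz, hz1, hz2⟩ := hψD.exists_mem_energySpace_of_hasWeakGradient hk
  have hw := (energySpace q).sub_mem hy hz
  obtain ⟨i1, -, e1⟩ := hgs _ _ (memD_of_mem_energySpace hw) (hasWeakGradient_of_mem_energySpace hw)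
  obtain ⟨i2, -, e2⟩ := hks _ _ (memD_of_mem_energySpace hw) (hasWeakGradient_of_mem_energySpace hw)
  have hw2 : (y - z).2 =ᵐ[volume] fun x => g x - k x := by
    filter_upwards [Lp.coeFn_sub y.2 z.2, hy2, hz2] with x h1 h2 h3
    rw [Prod.snd_sub, h1, Pi.sub_apply, h2, h3]
  have h0 : ∫ x, (‖g x‖ ^ (q - 2) * ⟪g x, (y - z).2 x⟫ -
      ‖k x‖ ^ (q - 2) * ⟪k x, (y - z).2 x⟫) = 0 := by
    rw [integral_sub i1 i2, e1, e2, sub_self]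
  have hnn : 0 ≤ᵐ[volume] fun x => ‖g x‖ ^ (q - 2) * ⟪g x, (y - z).2 x⟫ -
      ‖k x‖ ^ (q - 2) * ⟪k x, (y - z).2 x⟫ := by
    filter_upwards [hw2] with x hx
    rw [hx]
    exact (rpow_sub_two_mul_inner_sub_nonneg hq1 (g x) (k x)).1
  have hz0 := (integral_eq_zero_iff_of_nonneg_ae hnn (i1.sub i2)).1 h0
  have hw0 : (y - z).2 = 0 := by
    refine Lp.ext ?_
    filter_upwards [hz0, hw2, Lp.coeFn_zero E3 (ENNReal.ofReal q) (volume : Measure E3)]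
      with x h1 h2 h3
    rw [h2] at h1
    rw [h2, h3, (rpow_sub_two_mul_inner_sub_nonneg hq1 (g x) (k x)).2 h1, sub_self]
    rfl
  obtain ⟨C, -, hC⟩ := norm_le_of_mem_energySpace hq1 hq3
  have hw1 := hC _ hw
  rw [hw0, norm_zero, mul_zero, Prod.fst_sub, norm_le_zero_iff, sub_eq_zero] at hw1
  filter_upwards [hy1, hz1] with x h1 h2
  rw [← h1, ← h2, hw1]

end QPoisson

end

theorem proposition2p1 (p q s : ℝ) (hp1 : 1 < p) (hp3 : p < 3) (hq1 : 1 < q) (hq3 : q < 3)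
    (hs1 : (QPoisson.sobolevExp q - 1) * p / QPoisson.sobolevExp q < s)
    (hs2 : s < (QPoisson.sobolevExp q - 1) * QPoisson.sobolevExp p / QPoisson.sobolevExp q)
    (u : QPoisson.E3 → ℝ) (hu : QPoisson.MemW p u) :
    ∃ φ : QPoisson.E3 → ℝ, QPoisson.IsWeakSolution q s u φ ∧
      ∀ ψ : QPoisson.E3 → ℝ, QPoisson.IsWeakSolution q s u ψ → ψ =ᵐ[volume] φ := by
  obtain ⟨φ, hφ⟩ := QPoisson.exists_isWeakSolution hq1 hq3
    (hu.memLp_abs_rpow hp1 hp3 hq1 hq3 hs1 hs2)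
  exact ⟨φ, hφ, fun ψ hψ => hψ.ae_unique hq1 hq3 hφ⟩
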